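/- For $m\ge 0$ let $[m]=\{0<1<\dots<m\}$, regarded as a category, and let $[-1]=\varnothing$. For a (strict) 2-category $\mathcal C$, the Duskin nerve $N\mathcal C$ is the 3-coskeletal simplicial set whose 0-simplices are the objects, whose 1-simplices are the 1-morphisms, whose 2-simplices are the 2-cells $c\Rightarrow b\circ a$ with $a\colon x\to y$, $b\colon y\to z$, $c\colon x\to z$, and whose 3-simplices are the quadruples of 2-cells on the faces of a tetrahedron satisfying the tetrahedron (pasting) relation. Thus an $n$-simplex $\tau$ of $N\mathcal C$ consists of objects $\tau_p$ $(0\le p\le n)$, 1-morphisms $\tau_{pq}\colon\tau_p\to\tau_q$ and 2-cells $\tau_{pqs}\colon\tau_{ps}\Rightarrow\tau_{qs}\circ\tau_{pq}$ $(p\le q\le s)$, identities on degenerate edges and triangles, satisfying the tetrahedron relations. For categories $\mathcal D_1,\dots,\mathcal D_r$ $(r\ge0)$, the $(r+1)$-point suspension $\Sigma[\mathcal D_1,\dots,\mathcal D_r]$ is the 2-category with objects $x_0,\dots,x_r$ and hom-categories $\mathrm{Map}(x_i,x_j)=\mathcal D_{i+1}\times\dots\times\mathcal D_j$ if $i<j$,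 $[0]$ if $i=j$, and $\varnothing$ if $i>j$, with composition given by concatenation of tuples. For a category $\mathcal D$, let $\mathrm{Mat}(\mathcal D)$ be the simplicial set whose $n$-simplices are the triples $(k,l,\sigma\colon[k]\times[l]^{\mathrm{op}}\to\mathcal D)$ with $k,l\ge-1$, $k+l=n-1$ and $\sigma$ a functor. Its simplicial operators are given by precomposition, where $[n]$ is identified with $[k]$ (the row indices) followed by $[l]$ (the column indices): the $i$-th face (degeneracy) deletes (doubles) the row $i$ if $i\le k$, and the column $i-(k+1)$ if $i>k$. **Theorem.** There is an isomorphism of simplicial sets from $N\Sigma[\mathcal D_1,\dots,\mathcal D_r]$ onto the simplicial subset of $\mathrm{Mat}(\mathcal D_1)\times\dots\times\mathrm{Mat}(\mathcal D_r)$ whose $n$-simplices are the $r$-tuples of matrices $\sigma_i\colon[k_i]\times[l_i]^{\mathrm{op}}\to\mathcal D_i$, with $k_i,l_i\ge-1$ and $k_i+l_i=n-1$, such that $k_i\le k_j$ for $1\le i\le j\le r$. Thus an $n$-simplex of $N\Sigma[\mathcal D_1,\dots,\mathcal D_r]$ is uniquely such an $r$-tuple, and the simplicial structure is the one induced by $\mathrm{Mat}(\mathcal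 D_1)\times\dots\times\mathrm{Mat}(\mathcal D_r)$. Under this isomorphism, the matrices $\sigma_i$ of an $n$-simplex $\tau$ are as follows. The vertices $0,\dots,k_i$ of $\tau$ are exactly those sent to one of $x_0,\dots,x_{i-1}$. The entry $\sigma_i(s,t)$ is the $\mathcal D_i$-component of the edge $\tau_{s,\,k_i+1+t}$. The morphism $\sigma_i(s,t)\to\sigma_i(s',t)$, $s\le s'$, is the $\mathcal D_i$-component of the 2-cell $\tau_{s,\,s',\,k_i+1+t}$, and the morphism $\sigma_i(s,t')\to\sigma_i(s,t)$, $t\le t'$, is that of $\tau_{s,\,k_i+1+t,\,k_i+1+t'}$. In particular, for all $n_1,\dots,n_r\ge0$, this describes in the same way the Duskin nerve of the object $[r|n_1,\dots,n_r]=\Sigma[[n_1],\dots,[n_r]]$ of Joyal's $\Theta_2$. -/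

import Mathlib

open CategoryTheory Opposite Bicategory

universe w v u

/-! ### The Duskin nerve -/

/-- An `n`-simplex of the Duskin nerve of a 2-category `C`: objects `obj i`, 1-morphisms
`hom : obj i ⟶ obj j` for `i ≤ j`, and 2-cells `cell : hom i k ⟶ hom i j ≫ hom j k` (from the long
edge to the composite) for `i ≤ j ≤ k`, normalized on degenerate edges and triangles, such that
every 3-dimensional face `i ≤ j ≤ k ≤ l` satisfies the tetrahedron relation.  Equivalently,
a strictly unitary oplax functor `[n] → C`; as the only data are in dimension at most `2` and
the only relations in dimension `3`, this is the 3-coskeletal simplicial set whose simplices of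
dimension at most `3` are the objects, 1-morphisms, 2-cells `c ⟶ a ≫ b`, and quadruples of 2-cells
satisfying the tetrahedron relation. (`f ≫ g` is the composite `g ∘ f`.) -/
@[ext]
structure DuskinSimplex (C : Type w) [Bicategory.{v, u} C] (n : ℕ) where
  obj : Fin (n + 1) → C
  hom : ∀ {i j : Fin (n + 1)}, i ≤ j → (obj i ⟶ obj j)
  cell : ∀ {i j k : Fin (n + 1)} (hij : i ≤ j) (hjk : j ≤ k),
    hom (hij.trans hjk) ⟶ hom hij ≫ hom hjk
  hom_refl : ∀ i : Fin (n + 1), hom (le_refl i) = 𝟙 (obj i)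
  cell_refl_left : ∀ {i j : Fin (n + 1)} (h : i ≤ j),
    cell (le_refl i) h = (λ_ (hom h)).inv ≫ eqToHom (hom_refl i).symm ▷ hom h
  cell_refl_right : ∀ {i j : Fin (n + 1)} (h : i ≤ j),
    cell h (le_refl j) = (ρ_ (hom h)).inv ≫ hom h ◁ eqToHom (hom_refl j).symm
  tetrahedron : ∀ {i j k l : Fin (n + 1)} (hij : i ≤ j) (hjk : j ≤ k) (hkl : k ≤ l),
    cell hij (hjk.trans hkl) ≫ hom hij ◁ cell hjk hkl =
      cell (hij.trans hjk) hkl ≫ cell hij hjk ▷ hom hkl ≫ (α_ (hom hij) (hom hjk) (hom hkl)).hom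

/-- The simplicial operator on simplices of the Duskin nerve induced by a monotone map. -/
def DuskinSimplex.pullback {C : Type w} [Bicategory.{v, u} C] {m n : ℕ}
    (σ : DuskinSimplex C n) (f : Fin (m + 1) →o Fin (n + 1)) : DuskinSimplex C m where
  obj i := σ.obj (f i)
  hom h := σ.hom (f.monotone h)
  cell h h' := σ.cell (f.monotone h) (f.monotone h')
  hom_refl i := σ.hom_refl (f i)
  cell_refl_left h := σ.cell_refl_left (f.monotone h)
  cell_refl_right h := σ.cell_refl_right (f.monotone h)
  tetrahedron h h' h'' := σ.tetrahedron (f.monotone h) (f.monotone h') (f.monotone h'')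

/-- The Duskin nerve of a 2-category. -/
def duskinNerve (C : Type w) [Bicategory.{v, u} C] : SSet.{max w v u} where
  obj n := DuskinSimplex C n.unop.len
  map f := ↾fun σ => σ.pullback f.unop.toOrderHom
  map_id _ := rfl
  map_comp _ _ := rfl

/-! ### The `(r+1)`-point suspension -/

/-- The objects `x_0, …, x_r` of the `(r+1)`-point suspension of categories `D 0, …, D (r-1)`. -/
@[ext]
structure MultiSuspension {r : ℕ} (D : Fin r → Type u) where
  idx : Fin (r + 1)

namespace MultiSuspension

variable {r : ℕ} {D : Fin r → Type u}

/-- The 1-morphisms `x_i ⟶ x_j`: there are none if `i > j`, and for `i ≤ j` they are the objects of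
the product of the categories `D m` over `i ≤ m < j` (a one-point set if `i = j`). Since the
categories are numbered from `0`, the category `D m` sits between `x_m` and `x_{m+1}`. -/
@[ext]
structure Hom (a b : MultiSuspension D) where
  le : a.idx ≤ b.idx
  val : ∀ m : Fin r, a.idx ≤ m.castSucc → m.castSucc < b.idx → D m

/-- The identity 1-morphism. -/
def Hom.id (a : MultiSuspension D) : Hom a a where
  le := le_rfl
  val _ h h' := absurd h' (not_lt.2 h)

/-- Composition of 1-morphisms: concatenation of tuples. -/
def Hom.comp {a b c : MultiSuspension D} (f : Hom a b) (g : Hom b c) : Hom a c where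
  le := f.le.trans g.le
  val m h h' := if hb : m.castSucc < b.idx then f.val m h hb else g.val m (not_lt.1 hb) h'

lemma Hom.comp_val_left {a b c : MultiSuspension D} (f : Hom a b) (g : Hom b c) (m : Fin r)
    (h : a.idx ≤ m.castSucc) (h' : m.castSucc < c.idx) (hb : m.castSucc < b.idx) :
    (f.comp g).val m h h' = f.val m h hb := dif_pos hb

lemma Hom.comp_val_right {a b c : MultiSuspension D} (f : Hom a b) (g : Hom b c) (m : Fin r)
    (h : a.idx ≤ m.castSucc) (h' : m.castSucc < c.idx) (hb : b.idx ≤ m.castSucc) :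
    (f.comp g).val m h h' = g.val m hb h' := dif_neg (not_lt.2 hb)

lemma Hom.id_comp {a b : MultiSuspension D} (f : Hom a b) : (Hom.id a).comp f = f := by
  ext m h h'
  exact comp_val_right _ _ _ _ _ h

lemma Hom.comp_id {a b : MultiSuspension D} (f : Hom a b) : f.comp (Hom.id b) = f := by
  ext m h h'
  exact comp_val_left _ _ _ _ _ h'

lemma Hom.assoc {a b c d : MultiSuspension D} (f : Hom a b) (g : Hom b c) (k : Hom c d) :
    (f.comp g).comp k = f.comp (g.comp k) := by
  ext m h h'
  by_cases hb : m.castSucc < b.idx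
  · rw [comp_val_left _ _ _ _ _ (hb.trans_le g.le), comp_val_left _ _ _ _ _ hb,
      comp_val_left _ _ _ _ _ hb]
  · rw [comp_val_right f _ _ _ _ (not_lt.1 hb)]
    by_cases hc : m.castSucc < c.idx
    · rw [comp_val_left _ _ _ _ _ hc, comp_val_left _ _ _ _ _ hc,
        comp_val_right _ _ _ _ _ (not_lt.1 hb)]
    · rw [comp_val_right _ _ _ _ _ (not_lt.1 hc), comp_val_right _ _ _ _ _ (not_lt.1 hc)]

variable [∀ i, Category.{v} (D i)]

/-- The 2-morphisms: morphisms of the product category. -/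
@[ext]
structure Hom₂ {a b : MultiSuspension D} (f g : Hom a b) where
  app : ∀ (m : Fin r) (h : a.idx ≤ m.castSucc) (h' : m.castSucc < b.idx),
    f.val m h h' ⟶ g.val m h h'

instance (a b : MultiSuspension D) : Category.{v} (Hom a b) where
  Hom f g := Hom₂ f g
  id f := ⟨fun _ _ _ => 𝟙 _⟩
  comp η θ := ⟨fun m h h' => η.app m h h' ≫ θ.app m h h'⟩
  id_comp η := by ext; exact Category.id_comp _
  comp_id η := by ext; exact Category.comp_id _
  assoc η θ κ := by ext; exact Category.assoc _ _ _

section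

variable {a b c d : MultiSuspension D}

@[ext]
lemma hom₂_ext {f g : Hom a b} {η θ : f ⟶ g} (h : ∀ m h h', η.app m h h' = θ.app m h h') :
    η = θ := Hom₂.ext (by funext m h₁ h₂; exact h m h₁ h₂)

@[simp]
lemma id_app (f : Hom a b) (m : Fin r) (h h') : Hom₂.app (𝟙 f) m h h' = 𝟙 _ := rfl

@[simp]
lemma comp_app {f g k : Hom a b} (η : f ⟶ g) (θ : g ⟶ k) (m : Fin r) (h h') :
    Hom₂.app (η ≫ θ) m h h' = η.app m h h' ≫ θ.app m h h' := rfl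

@[simp]
lemma eqToHom_app {f g : Hom a b} (e : f = g) (m : Fin r) (h h') :
    Hom₂.app (eqToHom e) m h h' = eqToHom (by rw [e]) := by
  subst e; rfl

/-- Left whiskering: the identity on the components of `f`, and `η` on the others. -/
def whiskerLeft (f : Hom a b) {g g' : Hom b c} (η : g ⟶ g') : f.comp g ⟶ f.comp g' where
  app m h h' :=
    if hb : m.castSucc < b.idx then
      eqToHom (by rw [Hom.comp_val_left _ _ _ _ _ hb, Hom.comp_val_left _ _ _ _ _ hb])
    else
      eqToHom (Hom.comp_val_right _ _ _ _ _ (not_lt.1 hb)) ≫ η.app m (not_lt.1 hb) h' ≫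
        eqToHom (Hom.comp_val_right _ _ _ _ _ (not_lt.1 hb)).symm

/-- Right whiskering: `η` on the components of its source, and the identity on those of `g`. -/
def whiskerRight {f f' : Hom a b} (η : f ⟶ f') (g : Hom b c) : f.comp g ⟶ f'.comp g where
  app m h h' :=
    if hb : m.castSucc < b.idx then
      eqToHom (Hom.comp_val_left _ _ _ _ _ hb) ≫ η.app m h hb ≫
        eqToHom (Hom.comp_val_left _ _ _ _ _ hb).symm
    else
      eqToHom (by rw [Hom.comp_val_right _ _ _ _ _ (not_lt.1 hb),
        Hom.comp_val_right _ _ _ _ _ (not_lt.1 hb)])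

lemma eqToHom_whiskerRight' {f f' : Hom a b} (e : f = f') (g : Hom b c) :
    whiskerRight (eqToHom e) g = eqToHom (by rw [e]) := by
  subst e; ext m h h'; simp [whiskerRight]

lemma whiskerLeft_eqToHom' (f : Hom a b) {g g' : Hom b c} (e : g = g') :
    whiskerLeft f (eqToHom e) = eqToHom (by rw [e]) := by
  subst e; ext m h h'; simp [whiskerLeft]

end

/-- The `(r+1)`-point suspension of categories `D 0, …, D (r-1)`. -/
instance : Bicategory.{v, u} (MultiSuspension D) where
  Hom a b := Hom a b
  id a := Hom.id a
  comp f g := Hom.comp f g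
  whiskerLeft f _ _ η := whiskerLeft f η
  whiskerRight η g := whiskerRight η g
  associator f g k := eqToIso (Hom.assoc f g k)
  leftUnitor f := eqToIso (Hom.id_comp f)
  rightUnitor f := eqToIso (Hom.comp_id f)
  whiskerLeft_id f g := by ext m h h'; simp [whiskerLeft]
  whiskerLeft_comp f _ _ _ η θ := by
    ext m h h'; simp only [whiskerLeft, comp_app]; split <;> simp
  id_whiskerLeft η := by
    ext m h h'
    have hb : ¬ _ := not_lt.2 h
    simp [whiskerLeft, hb]
  comp_whiskerLeft {_ b c _} f g _ _ η := by
    ext m h h'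
    by_cases hb : m.castSucc < b.idx
    · have hc := hb.trans_le g.le
      simp [whiskerLeft, hb, hc]
    · by_cases hc : m.castSucc < c.idx <;> simp [whiskerLeft, hb, hc]
  id_whiskerRight f g := by ext m h h'; simp [whiskerRight]
  comp_whiskerRight η θ g := by
    ext m h h'; simp only [whiskerRight, comp_app]; split <;> simp
  whiskerRight_id η := by
    ext m h h'
    simp [whiskerRight, h']
  whiskerRight_comp {_ b c _ _ _} η g k := by
    ext m h h'
    by_cases hb : m.castSucc < b.idx
    · have hc := hb.trans_le g.le
      simp [whiskerRight, hb, hc]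
    · by_cases hc : m.castSucc < c.idx <;> simp [whiskerRight, hb, hc]
  whisker_assoc {_ b c _} f g _ η k := by
    ext m h h'
    by_cases hb : m.castSucc < b.idx
    · have hc := hb.trans_le g.le
      simp [whiskerRight, whiskerLeft, hb, hc]
    · by_cases hc : m.castSucc < c.idx <;> simp [whiskerRight, whiskerLeft, hb, hc]
  whisker_exchange η θ := by
    ext m h h'; simp only [whiskerRight, whiskerLeft, comp_app]; split <;> simp
  pentagon f g k l := by simp [eqToHom_whiskerRight', whiskerLeft_eqToHom']
  triangle f g := by simp [eqToHom_whiskerRight', whiskerLeft_eqToHom']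

/-- The `(r+1)`-point suspension is a strict 2-category. -/
instance : Bicategory.Strict (MultiSuspension D) where
  id_comp f := Hom.id_comp f
  comp_id f := Hom.comp_id f
  assoc f g k := Hom.assoc f g k
  leftUnitor_eqToIso _ := rfl
  rightUnitor_eqToIso _ := rfl
  associator_eqToIso _ _ _ := rfl

end MultiSuspension

/-- The 2-category `[r | n_1, …, n_r]` of Joyal's cell category `Θ₂`: the `(r+1)`-point suspension
of the ordinals `[n_1], …, [n_r]`. -/
abbrev ThetaTwoCell (r : ℕ) (n : Fin r → ℕ) : Type :=
  MultiSuspension fun i => Fin (n i + 1)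

/-! ### Matrices valued in a category -/

/-- An `n`-simplex `(k, l, σ : [k] × [l]ᵒᵖ ⥤ D)`, `k, l ≥ -1`, `k + l = n - 1`, of the simplicial
set of `D`-valued matrices. Here `rows = k + 1` and `cols = l + 1`, so that `[k] = Fin rows` and
`[l] = Fin cols`. -/
structure CatMatrix (D : Type u) [Category.{v} D] (n : ℕ) where
  rows : ℕ
  cols : ℕ
  rows_add_cols : rows + cols = n + 1
  mat : Fin rows × (Fin cols)ᵒᵖ ⥤ D

namespace CatMatrix

/-- The functor between index posets induced by monotone maps of row and column indices. -/
abbrev indexFunctor {a a' b b' : ℕ} (f : Fin a →o Fin a') (g : Fin b →o Fin b') :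
    Fin a × (Fin b)ᵒᵖ ⥤ Fin a' × (Fin b')ᵒᵖ :=
  f.monotone.functor.prod g.monotone.functor.op

section

variable {m n : ℕ} (f : Fin (m + 1) →o Fin (n + 1)) (R : ℕ)

/-- The number of elements of `[m]` that a monotone map `f : [m] → [n]` sends to one of the
first `R` elements of `[n]`. -/
def restrictRows : ℕ := (Finset.univ.filter fun t : Fin (m + 1) => (f t : ℕ) < R).card

lemma restrictRows_le : restrictRows f R ≤ m + 1 :=
  (Finset.card_le_univ _).trans (by simp)

lemma lt_restrictRows (t : Fin (m + 1)) : (t : ℕ) < restrictRows f R ↔ (f t : ℕ) < R := by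
  constructor
  · intro h
    by_contra hR
    have : restrictRows f R ≤ (Finset.Iio t).card := by
      refine Finset.card_le_card fun s hs => ?_
      simp only [Finset.mem_filter, Finset.mem_univ, true_and] at hs
      rw [Finset.mem_Iio]
      by_contra hst
      have : (f t : ℕ) ≤ f s := f.monotone (not_lt.1 hst)
      omega
    rw [Fin.card_Iio] at this
    omega
  · intro h
    have : (Finset.Iic t).card ≤ restrictRows f R := by
      refine Finset.card_le_card fun s hs => ?_
      simp only [Finset.mem_filter, Finset.mem_univ, true_and]
      have : (f s : ℕ) ≤ f t := f.monotone (Finset.mem_Iic.1 hs)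
      omega
    rw [Fin.card_Iic] at this
    omega

variable {R}

/-- The monotone map `f` on the first `restrictRows f R` indices. -/
def rowMap : Fin (restrictRows f R) →o Fin R where
  toFun s := ⟨f ⟨s, s.2.trans_le (restrictRows_le f R)⟩, (lt_restrictRows f R _).1 s.2⟩
  monotone' _ _ h := f.monotone h

/-- The monotone map `f` on the remaining indices. -/
def colMap {L : ℕ} (hL : R + L = n + 1) : Fin (m + 1 - restrictRows f R) →o Fin L where
  toFun t := ⟨f ⟨restrictRows f R + t, by have := t.2; omega⟩ - R, by
    have h := (lt_restrictRows f R ⟨restrictRows f R + t, by have := t.2; omega⟩).not.1 (by simp)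
    have := (f ⟨restrictRows f R + t, by have := t.2; omega⟩).2
    omega⟩
  monotone' s t h := Nat.sub_le_sub_right
    (f.monotone (show (⟨_, _⟩ : Fin (m + 1)) ≤ ⟨_, _⟩ from Nat.add_le_add_left h _)) _

end

variable {D : Type u} [Category.{v} D]

/-- The simplicial operator on matrices: a monotone map `f : [m] → [n]` acts on the indices
`0, …, k` of the rows and on the indices `k+1, …, n` of the columns, so that cofaces remove a
row or a column, and codegeneracies double one. -/
def pullback {m n : ℕ} (M : CatMatrix D n) (f : Fin (m + 1) →o Fin (n + 1)) : CatMatrix D m where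
  rows := restrictRows f M.rows
  cols := m + 1 - restrictRows f M.rows
  rows_add_cols := Nat.add_sub_of_le (restrictRows_le f M.rows)
  mat := indexFunctor (rowMap f) (colMap f M.rows_add_cols) ⋙ M.mat

lemma ext_of_eq {n : ℕ} {M N : CatMatrix D n} (h : M.rows = N.rows) (h' : M.cols = N.cols)
    (e : M.mat = indexFunctor (Fin.castOrderIso h : Fin _ →o Fin _)
      (Fin.castOrderIso h' : Fin _ →o Fin _) ⋙ N.mat) : M = N := by
  obtain ⟨a, b, hab, σ⟩ := M
  obtain ⟨a', b', hab', τ⟩ := N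
  dsimp only at h h'
  subst h h'
  congr 1

lemma indexFunctor_congr {a a' b b' : ℕ} {F G : Fin a × (Fin b)ᵒᵖ ⥤ Fin a' × (Fin b')ᵒᵖ}
    (h : ∀ x, F.obj x = G.obj x) : F = G :=
  CategoryTheory.Functor.ext h fun _ _ _ =>
    Prod.ext (Subsingleton.elim _ _) (Quiver.Hom.unop_inj (Subsingleton.elim _ _))

lemma pullback_id {n : ℕ} (M : CatMatrix D n) : M.pullback OrderHom.id = M := by
  have h : restrictRows (OrderHom.id : Fin (n + 1) →o Fin (n + 1)) M.rows = M.rows := by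
    have h₁ := restrictRows_le (OrderHom.id : Fin (n + 1) →o Fin (n + 1)) M.rows
    have h₂ := M.rows_add_cols
    have h₃ := lt_restrictRows (OrderHom.id : Fin (n + 1) →o Fin (n + 1)) M.rows
    refine le_antisymm ?_ ?_ <;> by_contra! hlt
    · exact lt_irrefl _ ((h₃ ⟨M.rows, by omega⟩).1 hlt)
    · exact lt_irrefl _ ((h₃ ⟨restrictRows OrderHom.id M.rows, by omega⟩).2 hlt)
  refine ext_of_eq h ?_ ?_
  · have := M.rows_add_cols
    simp only [pullback, h]
    omega
  · refine congrArg (· ⋙ M.mat) (indexFunctor_congr fun x => ?_)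
    refine Prod.ext rfl (Opposite.unop_injective (Fin.ext ?_))
    change restrictRows _ _ + (x.2.unop : ℕ) - M.rows = x.2.unop
    omega

lemma pullback_comp {k m n : ℕ} (M : CatMatrix D n) (f : Fin (m + 1) →o Fin (n + 1))
    (g : Fin (k + 1) →o Fin (m + 1)) : M.pullback (f.comp g) = (M.pullback f).pullback g := by
  have h : restrictRows (f.comp g) M.rows = restrictRows g (restrictRows f M.rows) := by
    simp only [restrictRows.eq_def g, lt_restrictRows]
    rfl
  refine ext_of_eq h ?_ ?_
  · simp only [pullback, h]
  · refine congrArg (· ⋙ M.mat) (indexFunctor_congr (F := indexFunctor _ _)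
      (G := indexFunctor _ _ ⋙ indexFunctor _ _ ⋙ indexFunctor _ _) fun x => ?_)
    refine Prod.ext rfl (Opposite.unop_injective (Fin.ext ?_))
    refine congrArg (fun t => (f t : ℕ) - M.rows) (Fin.ext ?_)
    have hx := x.2.unop.2
    have hlt : restrictRows (f.comp g) M.rows + (x.2.unop : ℕ) < k + 1 := by omega
    have h₁ := (lt_restrictRows g (restrictRows f M.rows)
      ⟨restrictRows (f.comp g) M.rows + (x.2.unop : ℕ), hlt⟩).not.1 (by simp [h])
    change (g ⟨restrictRows (f.comp g) M.rows + (x.2.unop : ℕ), hlt⟩ : ℕ) =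
      restrictRows f M.rows + ((g ⟨restrictRows g (restrictRows f M.rows) + (x.2.unop : ℕ), _⟩ : ℕ) -
        restrictRows f M.rows)
    simp only [h] at h₁ ⊢
    omega

/-- The simplicial operators on matrices are given by precomposition: an operator which is the
ordinal sum of a map `p` of row indices and a map `q` of column indices (such as a coface or
a codegeneracy, where one of the two is a coface or codegeneracy and the other is the identity)
acts by precomposing with `p × qᵒᵖ`. -/
lemma pullback_eq {m n a b R L : ℕ} (hRL : R + L = n + 1) (σ : Fin R × (Fin L)ᵒᵖ ⥤ D)
    (hab : a + b = m + 1) (f : Fin (m + 1) →o Fin (n + 1)) (p : Fin a →o Fin R)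
    (q : Fin b →o Fin L) (hp : ∀ s : Fin a, (f ⟨s, by omega⟩ : ℕ) = p s)
    (hq : ∀ t : Fin b, (f ⟨a + t, by omega⟩ : ℕ) = R + q t) :
    CatMatrix.pullback ⟨R, L, hRL, σ⟩ f = ⟨a, b, hab, indexFunctor p q ⋙ σ⟩ := by
  have key : ∀ t : Fin (m + 1), (t : ℕ) < restrictRows f R ↔ (t : ℕ) < a := by
    intro t
    rw [lt_restrictRows]
    constructor
    · intro h
      by_contra ht
      have h₁ := hq ⟨t - a, by omega⟩
      have h₂ : (⟨a + (t - a), by omega⟩ : Fin (m + 1)) = t := Fin.ext (by simp only; omega)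
      rw [h₂] at h₁
      omega
    · intro h
      have := hp ⟨t, h⟩
      simp only [Fin.eta] at this
      omega
  have h : restrictRows f R = a := by
    have h₁ := restrictRows_le f R
    refine le_antisymm ?_ ?_ <;> by_contra! hlt
    · exact lt_irrefl _ ((key ⟨a, by omega⟩).1 hlt)
    · exact lt_irrefl _ ((key ⟨restrictRows f R, by omega⟩).2 hlt)
  have h' : m + 1 - restrictRows f R = b := by omega
  refine ext_of_eq h h' ?_
  refine congrArg (· ⋙ σ) (indexFunctor_congr (F := indexFunctor _ _)
    (G := indexFunctor _ _ ⋙ indexFunctor _ _) fun x => ?_)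
  refine Prod.ext (Fin.ext (hp ⟨x.1, x.1.2.trans_eq h⟩)) (Opposite.unop_injective (Fin.ext ?_))
  have hx := x.2.unop.2
  have h₁ := hq ⟨x.2.unop, hx.trans_eq h'⟩
  change (f ⟨restrictRows f R + (x.2.unop : ℕ), _⟩ : ℕ) - R = q ⟨x.2.unop, _⟩
  simp only [h]
  exact (congrArg (· - R) h₁).trans (Nat.add_sub_cancel_left _ _)

/-- The vertex of the `n`-simplex that corresponds to a row of a matrix. -/
def rowIdx {n : ℕ} (M : CatMatrix D n) (s : Fin M.rows) : Fin (n + 1) :=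
  ⟨s, by have := M.rows_add_cols; omega⟩

/-- The vertex of the `n`-simplex that corresponds to a column of a matrix. -/
def colIdx {n : ℕ} (M : CatMatrix D n) (t : Fin M.cols) : Fin (n + 1) :=
  ⟨M.rows + t, by have := M.rows_add_cols; omega⟩

lemma rowIdx_le_rowIdx {n : ℕ} (M : CatMatrix D n) {s s' : Fin M.rows} (h : s ≤ s') :
    M.rowIdx s ≤ M.rowIdx s' := h

lemma colIdx_le_colIdx {n : ℕ} (M : CatMatrix D n) {t t' : Fin M.cols} (h : t ≤ t') :
    M.colIdx t ≤ M.colIdx t' := Nat.add_le_add_left h _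

lemma rowIdx_le_colIdx {n : ℕ} (M : CatMatrix D n) (s : Fin M.rows) (t : Fin M.cols) :
    M.rowIdx s ≤ M.colIdx t := s.2.le.trans (Nat.le_add_right _ _)

end CatMatrix

/-- The simplicial set of `D`-valued matrices. -/
def matrixNerve (D : Type u) [Category.{v} D] : SSet.{max u v} where
  obj n := CatMatrix D n.unop.len
  map f := ↾fun M => M.pullback f.unop.toOrderHom
  map_id _ := by ext M; exact M.pullback_id
  map_comp f g := by ext M; exact M.pullback_comp f.unop.toOrderHom g.unop.toOrderHom

section

variable {r : ℕ} (D : Fin r → Type u) [∀ i, Category.{v} (D i)]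

/-- The product of the simplicial sets of matrices valued in the categories `D i`. -/
def matrixNerveProduct : SSet.{max u v} where
  obj n := ∀ i, (matrixNerve (D i)).obj n
  map f := ↾fun M i => (matrixNerve (D i)).map f (M i)
  map_id n := by ext M i; simp
  map_comp f g := by ext M i; simp

/-- The simplicial subset of the product consisting of the tuples of matrices whose numbers of
rows form a weakly increasing sequence. -/
def monotoneMatrixTuples : (matrixNerveProduct D).Subcomplex where
  obj n := {M : ∀ i, CatMatrix (D i) n.unop.len | ∀ i j, i ≤ j → (M i).rows ≤ (M j).rows}
  map f M hM i j hij := by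
    change CatMatrix.restrictRows _ (M i).rows ≤ CatMatrix.restrictRows _ (M j).rows
    refine Finset.card_le_card fun t ht => ?_
    simp only [Finset.mem_filter, Finset.mem_univ, true_and] at ht ⊢
    exact lt_of_lt_of_le ht (hM i j hij)

variable {D}

/-- `IsMatrixOf σ i M` says that `M` is the `i`-th matrix of the simplex `σ` of the Duskin nerve of
the `(r+1)`-point suspension. The rows of `M` correspond to the vertices of `σ` that lie in
`{x_0, …, x_i}`, and the columns to the vertices of `σ` that lie in `{x_{i+1}, …, x_r}`. The entry at
`(s, t)` is the component in `D i` of the edge of `σ` from `s` to `t`; the vertical morphism from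
`(s, t)` to `(s', t)` is the component in `D i` of the 2-cell of the triangle `s ≤ s' ≤ t`, and
the horizontal morphism from `(s, t')` to `(s, t)` is that of the triangle `s ≤ t ≤ t'`.
(The inequalities `h` and `h'` hold by the first condition; the heterogeneous equalities
identify `M(s, t)` with the corresponding component in `D i`.) -/
structure IsMatrixOf {n : ℕ} (σ : DuskinSimplex (MultiSuspension D) n) (i : Fin r)
    (M : CatMatrix (D i) n) : Prop where
  lt_rows_iff : ∀ t : Fin (n + 1), (t : ℕ) < M.rows ↔ (σ.obj t).idx ≤ i.castSucc
  obj_eq : ∀ (s : Fin M.rows) (t : Fin M.cols)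
    (h : (σ.obj (M.rowIdx s)).idx ≤ i.castSucc) (h' : i.castSucc < (σ.obj (M.colIdx t)).idx),
    M.mat.obj (s, op t) =
      MultiSuspension.Hom.val (σ.hom (M.rowIdx_le_colIdx s t)) i h h'
  map_vertical : ∀ (s s' : Fin M.rows) (hs : s ≤ s') (t : Fin M.cols)
    (h : (σ.obj (M.rowIdx s)).idx ≤ i.castSucc) (h' : i.castSucc < (σ.obj (M.colIdx t)).idx),
    HEq (M.mat.map (X := (s, op t)) (Y := (s', op t)) (homOfLE hs, 𝟙 (op t)))
      (MultiSuspension.Hom₂.app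
        (σ.cell (M.rowIdx_le_rowIdx hs) (M.rowIdx_le_colIdx s' t)) i h h')
  map_horizontal : ∀ (s : Fin M.rows) (t t' : Fin M.cols) (ht : t ≤ t')
    (h : (σ.obj (M.rowIdx s)).idx ≤ i.castSucc) (h' : i.castSucc < (σ.obj (M.colIdx t')).idx),
    HEq (M.mat.map (X := (s, op t')) (Y := (s, op t)) (𝟙 s, (homOfLE ht).op))
      (MultiSuspension.Hom₂.app
        (σ.cell (M.rowIdx_le_colIdx s t) (M.colIdx_le_colIdx ht)) i h h')

end

/-!
Fix a simplex `σ` of the Duskin nerve and `m : Fin r`. Since there is a 1-morphism `x_p ⟶ x_q` only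
if `p ≤ q`, the vertices of `σ` in `{x_0, …, x_m}` form an initial segment, the rows, and the
other vertices are the columns. An edge has a component in `D m` exactly if it goes from a row to a
column, and a 2-cell `a ≤ b ≤ c` exactly if `a` is a row and `c` a column. Composition in the
suspension is concatenation, so that in `D m` the composite of `a ≤ b` and `b ≤ c` is its factor
that goes from a row to a column: a 2-cell is a morphism from the entry `(a, c)` to `(b, c)` if `b`
is a row, to `(a, b)` if `b` is a column. The `D m`-component of a tetrahedron `a ≤ b ≤ c ≤ d` is
one of three relations, as the number of rows among `b`, `c` is two, one or zero: vertical morphisms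
compose (`DuskinSimplex.vertical_vertical`), vertical and horizontal ones commute
(`DuskinSimplex.vertical_horizontal`), or horizontal ones compose
(`DuskinSimplex.horizontal_horizontal`). Together with the normalization on degenerate triangles
these say precisely that the entries form a functor on `[k] × [l]ᵒᵖ`.

Conversely, a tuple of matrices with increasing numbers of rows defines a simplex
(`CatMatrix.suspensionSimplex`): a vertex goes to `x_p` with `p` the number of matrices in which it
is a column, and monotonicity ensures that these are the first `p` matrices.

Transport along equalities of objects is avoided by treating the correspondence as the relation
`IsMatrixOf`: each simplex has a matrix (`DuskinSimplex.isMatrixOf_matrix`), which is unique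
(`IsMatrixOf.eq`); the matrices determine the simplex (`DuskinSimplex.ext_of_isMatrixOf`); every
monotone tuple occurs (`CatMatrix.isMatrixOf_suspensionSimplex`); and the relation is stable under
simplicial operators (`IsMatrixOf.pullback`), which gives naturality.
-/

variable {r : ℕ} {D : Fin r → Type u} [∀ i, Category.{v} (D i)]

/-! ### Components of the structure 2-cells of the suspension -/

namespace MultiSuspension

variable {a b c d : MultiSuspension D}

lemma whiskerLeft_app_of_lt (f : a ⟶ b) {g g' : b ⟶ c} (η : g ⟶ g') (m : Fin r)
    (h : a.idx ≤ m.castSucc) (h' : m.castSucc < c.idx) (hb : m.castSucc < b.idx) :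
    Hom₂.app (f ◁ η) m h h' =
      eqToHom ((Hom.comp_val_left f g m h h' hb).trans
        (Hom.comp_val_left f g' m h h' hb).symm) :=
  dif_pos hb

lemma whiskerLeft_app_of_le (f : a ⟶ b) {g g' : b ⟶ c} (η : g ⟶ g') (m : Fin r)
    (h : a.idx ≤ m.castSucc) (h' : m.castSucc < c.idx) (hb : b.idx ≤ m.castSucc) :
    Hom₂.app (f ◁ η) m h h' =
      eqToHom (Hom.comp_val_right f g m h h' hb) ≫ Hom₂.app η m hb h' ≫
        eqToHom (Hom.comp_val_right f g' m h h' hb).symm :=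
  dif_neg (not_lt.2 hb)

lemma whiskerRight_app_of_lt {f f' : a ⟶ b} (η : f ⟶ f') (g : b ⟶ c) (m : Fin r)
    (h : a.idx ≤ m.castSucc) (h' : m.castSucc < c.idx) (hb : m.castSucc < b.idx) :
    Hom₂.app (η ▷ g) m h h' =
      eqToHom (Hom.comp_val_left f g m h h' hb) ≫ Hom₂.app η m h hb ≫
        eqToHom (Hom.comp_val_left f' g m h h' hb).symm :=
  dif_pos hb

lemma whiskerRight_app_of_le {f f' : a ⟶ b} (η : f ⟶ f') (g : b ⟶ c) (m : Fin r)
    (h : a.idx ≤ m.castSucc) (h' : m.castSucc < c.idx) (hb : b.idx ≤ m.castSucc) :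
    Hom₂.app (η ▷ g) m h h' =
      eqToHom ((Hom.comp_val_right f g m h h' hb).trans
        (Hom.comp_val_right f' g m h h' hb).symm) :=
  dif_neg (not_lt.2 hb)

lemma associator_hom_app (f : a ⟶ b) (g : b ⟶ c) (k : c ⟶ d) (m : Fin r)
    (h : a.idx ≤ m.castSucc) (h' : m.castSucc < d.idx) :
    Hom₂.app (α_ f g k).hom m h h' =
      eqToHom (congrArg (fun l : Hom a d => l.val m h h') (Hom.assoc f g k)) :=
  eqToHom_app (Hom.assoc f g k) _ _ _

lemma leftUnitor_inv_app (f : a ⟶ b) (m : Fin r)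
    (h : a.idx ≤ m.castSucc) (h' : m.castSucc < b.idx) :
    Hom₂.app (λ_ f).inv m h h' =
      eqToHom (congrArg (fun l : Hom a b => l.val m h h') (Hom.id_comp f).symm) :=
  eqToHom_app ((Hom.id_comp f).symm) _ _ _

lemma rightUnitor_inv_app (f : a ⟶ b) (m : Fin r)
    (h : a.idx ≤ m.castSucc) (h' : m.castSucc < b.idx) :
    Hom₂.app (ρ_ f).inv m h h' =
      eqToHom (congrArg (fun l : Hom a b => l.val m h h') (Hom.comp_id f).symm) :=
  eqToHom_app ((Hom.comp_id f).symm) _ _ _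

/-- The lemma `comp_app` for composites formed in the bicategory, as `simp` and `rw` do not see
through the two forms of the hom-categories. -/
lemma comp_app' {f g k : a ⟶ b} (η : f ⟶ g) (θ : g ⟶ k) (m : Fin r) (h h') :
    Hom₂.app (η ≫ θ) m h h' = Hom₂.app η m h h' ≫ Hom₂.app θ m h h' := rfl

end MultiSuspension

open MultiSuspension

/-! ### The components of a simplex of the Duskin nerve -/

namespace DuskinSimplex

variable {n : ℕ} (σ : DuskinSimplex (MultiSuspension D) n) (m : Fin r)

/-- The component in `D m` of the edge `a ≤ b` of `σ`, which exists when `a` lies in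
`{x_0, …, x_m}` and `b` in `{x_{m+1}, …, x_r}`. -/
abbrev entry {a b : Fin (n + 1)} (hab : a ≤ b) (ha : (σ.obj a).idx ≤ m.castSucc)
    (hb : m.castSucc < (σ.obj b).idx) : D m :=
  Hom.val (σ.hom hab) m ha hb

variable {a b c d : Fin (n + 1)}

/-- The component in `D m` of the 2-cell of a triangle `a ≤ b ≤ c` whose vertex `b` is a row: here
`D m` only sees the factor `b ≤ c` of the composite edge. -/
def vertical (hab : a ≤ b) (hbc : b ≤ c) (ha : (σ.obj a).idx ≤ m.castSucc)
    (hb : (σ.obj b).idx ≤ m.castSucc) (hc : m.castSucc < (σ.obj c).idx) :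
    σ.entry m (hab.trans hbc) ha hc ⟶ σ.entry m hbc hb hc :=
  Hom₂.app (σ.cell hab hbc) m ha hc ≫ eqToHom (Hom.comp_val_right _ _ _ _ _ hb)

/-- The component in `D m` of the 2-cell of a triangle `a ≤ b ≤ c` whose vertex `b` is a column:
here `D m` only sees the factor `a ≤ b` of the composite edge. -/
def horizontal (hab : a ≤ b) (hbc : b ≤ c) (ha : (σ.obj a).idx ≤ m.castSucc)
    (hb : m.castSucc < (σ.obj b).idx) (hc : m.castSucc < (σ.obj c).idx) :
    σ.entry m (hab.trans hbc) ha hc ⟶ σ.entry m hab ha hb :=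
  Hom₂.app (σ.cell hab hbc) m ha hc ≫ eqToHom (Hom.comp_val_left _ _ _ _ _ hb)

lemma vertical_refl (hac : a ≤ c) (ha : (σ.obj a).idx ≤ m.castSucc)
    (hc : m.castSucc < (σ.obj c).idx) :
    σ.vertical m le_rfl hac ha ha hc = 𝟙 _ := by
  simp only [vertical, cell_refl_left, comp_app', leftUnitor_inv_app,
    whiskerRight_app_of_le _ _ _ _ _ ha, eqToHom_trans, eqToHom_refl]

lemma horizontal_refl (hac : a ≤ c) (ha : (σ.obj a).idx ≤ m.castSucc)
    (hc : m.castSucc < (σ.obj c).idx) :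
    σ.horizontal m hac le_rfl ha hc hc = 𝟙 _ := by
  simp only [horizontal, cell_refl_right, comp_app', rightUnitor_inv_app,
    whiskerLeft_app_of_lt _ _ _ _ _ hc, eqToHom_trans, eqToHom_refl]

lemma tetrahedron_app (hab : a ≤ b) (hbc : b ≤ c) (hcd : c ≤ d)
    (ha : (σ.obj a).idx ≤ m.castSucc) (hd : m.castSucc < (σ.obj d).idx) :
    Hom₂.app (σ.cell hab (hbc.trans hcd)) m ha hd ≫
        Hom₂.app (σ.hom hab ◁ σ.cell hbc hcd) m ha hd =
      Hom₂.app (σ.cell (hab.trans hbc) hcd) m ha hd ≫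
        Hom₂.app (σ.cell hab hbc ▷ σ.hom hcd) m ha hd ≫
        Hom₂.app (α_ (σ.hom hab) (σ.hom hbc) (σ.hom hcd)).hom m ha hd :=
  congrArg (fun η => Hom₂.app η m ha hd) (σ.tetrahedron hab hbc hcd)

/-- The tetrahedron relation when `a`, `b`, `c` are rows. -/
lemma vertical_vertical (hab : a ≤ b) (hbc : b ≤ c) (hcd : c ≤ d)
    (ha : (σ.obj a).idx ≤ m.castSucc) (hb : (σ.obj b).idx ≤ m.castSucc)
    (hc : (σ.obj c).idx ≤ m.castSucc) (hd : m.castSucc < (σ.obj d).idx) :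
    σ.vertical m hab (hbc.trans hcd) ha hb hd ≫ σ.vertical m hbc hcd hb hc hd =
      σ.vertical m (hab.trans hbc) hcd ha hc hd := by
  have h := σ.tetrahedron_app m hab hbc hcd ha hd =≫
    eqToHom ((Hom.comp_val_right (σ.hom hab) (σ.hom hbc ≫ σ.hom hcd) m ha hd hb).trans
      (Hom.comp_val_right (σ.hom hbc) (σ.hom hcd) m hb hd hc))
  simpa only [whiskerLeft_app_of_le _ _ _ _ _ hb, whiskerRight_app_of_le _ _ _ _ _ hc,
    associator_hom_app, vertical, Category.assoc, eqToHom_trans] using h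

/-- The tetrahedron relation when `a`, `b` are rows and `c`, `d` are columns. -/
lemma vertical_horizontal (hab : a ≤ b) (hbc : b ≤ c) (hcd : c ≤ d)
    (ha : (σ.obj a).idx ≤ m.castSucc) (hb : (σ.obj b).idx ≤ m.castSucc)
    (hc : m.castSucc < (σ.obj c).idx) (hd : m.castSucc < (σ.obj d).idx) :
    σ.vertical m hab (hbc.trans hcd) ha hb hd ≫ σ.horizontal m hbc hcd hb hc hd =
      σ.horizontal m (hab.trans hbc) hcd ha hc hd ≫ σ.vertical m hab hbc ha hb hc := by
  have h := σ.tetrahedron_app m hab hbc hcd ha hd =≫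
    eqToHom ((Hom.comp_val_right (σ.hom hab) (σ.hom hbc ≫ σ.hom hcd) m ha hd hb).trans
      (Hom.comp_val_left (σ.hom hbc) (σ.hom hcd) m hb hd hc))
  simpa only [whiskerLeft_app_of_le _ _ _ _ _ hb, whiskerRight_app_of_lt _ _ _ _ _ hc,
    associator_hom_app, vertical, horizontal, Category.assoc, eqToHom_trans] using h

/-- The tetrahedron relation when `b`, `c`, `d` are columns. -/
lemma horizontal_horizontal (hab : a ≤ b) (hbc : b ≤ c) (hcd : c ≤ d)
    (ha : (σ.obj a).idx ≤ m.castSucc) (hb : m.castSucc < (σ.obj b).idx)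
    (hc : m.castSucc < (σ.obj c).idx) (hd : m.castSucc < (σ.obj d).idx) :
    σ.horizontal m (hab.trans hbc) hcd ha hc hd ≫ σ.horizontal m hab hbc ha hb hc =
      σ.horizontal m hab (hbc.trans hcd) ha hb hd := by
  have h := σ.tetrahedron_app m hab hbc hcd ha hd
  rw [whiskerLeft_app_of_lt _ _ _ _ _ hb, whiskerRight_app_of_lt _ _ _ _ _ hc,
    associator_hom_app, comp_eqToHom_iff] at h
  simp only [horizontal, h, Category.assoc, eqToHom_trans]

/-- The index of the object `x_p` at each vertex, as a monotone map `[n] → [r]`; it is monotone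
because there are no 1-morphisms `x_p ⟶ x_q` with `p > q`. -/
def idxHom : Fin (n + 1) →o Fin (r + 1) where
  toFun t := (σ.obj t).idx
  monotone' _ _ h := (show Hom _ _ from σ.hom h).le

end DuskinSimplex

/-! ### Functors out of a grid, and the rows and columns of a matrix -/

/-- A functor on `[k] × [l]ᵒᵖ` from its objects, its vertical and its horizontal morphisms; a
general morphism is sent to the vertical one followed by the horizontal one. -/
abbrev gridFunctor {C : Type u} [Category.{v} C] {R L : ℕ} (obj : Fin R → Fin L → C)
    (vert : ∀ {s s'} (_ : s ≤ s') (t), obj s t ⟶ obj s' t)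
    (horiz : ∀ (s) {t t'} (_ : t ≤ t'), obj s t' ⟶ obj s t)
    (vert_refl : ∀ s t, vert (le_refl s) t = 𝟙 _)
    (horiz_refl : ∀ s t, horiz s (le_refl t) = 𝟙 _)
    (vert_vert : ∀ {s s' s''} (h : s ≤ s') (h' : s' ≤ s'') (t),
      vert h t ≫ vert h' t = vert (h.trans h') t)
    (horiz_horiz : ∀ (s) {t t' t''} (h : t ≤ t') (h' : t' ≤ t''),
      horiz s h' ≫ horiz s h = horiz s (h.trans h'))
    (vert_horiz : ∀ {s s'} (h : s ≤ s') {t t'} (h' : t ≤ t'),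
      vert h t' ≫ horiz s' h' = horiz s h' ≫ vert h t) :
    Fin R × (Fin L)ᵒᵖ ⥤ C where
  obj x := obj x.1 x.2.unop
  map {x y} φ := vert (leOfHom φ.1) x.2.unop ≫ horiz y.1 (leOfHom φ.2.unop)
  map_id x := by simp only [vert_refl, horiz_refl, Category.comp_id]
  map_comp φ ψ := by
    rw [← vert_vert (leOfHom φ.1) (leOfHom ψ.1), ← horiz_horiz _ (leOfHom ψ.2.unop)
      (leOfHom φ.2.unop), Category.assoc, Category.assoc,
      reassoc_of% vert_horiz (leOfHom ψ.1) (leOfHom φ.2.unop)]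

lemma grid_hom_ext {R L : ℕ} {x y : Fin R × (Fin L)ᵒᵖ} (φ ψ : x ⟶ y) : φ = ψ :=
  Prod.ext (Subsingleton.elim _ _) (Quiver.Hom.unop_inj (Subsingleton.elim _ _))

lemma heq_comp_of_heq {C : Type u} [Category.{v} C] {X Y Z X' Y' Z' : C} {f : X ⟶ Y} {g : Y ⟶ Z}
    {f' : X' ⟶ Y'} {g' : Y' ⟶ Z'} (hX : X = X') (hY : Y = Y') (hZ : Z = Z') (hf : HEq f f')
    (hg : HEq g g') : HEq (f ≫ g) (f' ≫ g') := by
  subst hX hY hZ hf hg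
  rfl

/-- Functors on a grid are equal if they agree on objects and on vertical and horizontal
morphisms. -/
lemma gridFunctor_ext {C : Type u} [Category.{v} C] {R L : ℕ} {F G : Fin R × (Fin L)ᵒᵖ ⥤ C}
    (hobj : ∀ s t, F.obj (s, op t) = G.obj (s, op t))
    (hvert : ∀ (s s' : Fin R) (hs : s ≤ s') (t : Fin L),
      HEq (F.map (X := (s, op t)) (Y := (s', op t)) (homOfLE hs, 𝟙 (op t)))
        (G.map (X := (s, op t)) (Y := (s', op t)) (homOfLE hs, 𝟙 (op t))))
    (hhoriz : ∀ (s : Fin R) (t t' : Fin L) (ht : t ≤ t'),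
      HEq (F.map (X := (s, op t')) (Y := (s, op t)) (𝟙 s, (homOfLE ht).op))
        (G.map (X := (s, op t')) (Y := (s, op t)) (𝟙 s, (homOfLE ht).op))) : F = G := by
  refine Functor.hext (fun x => hobj x.1 x.2.unop) ?_
  rintro ⟨s, ⟨t'⟩⟩ ⟨s', ⟨t⟩⟩ φ
  have hφ : φ = (show ((s, op t') : Fin R × (Fin L)ᵒᵖ) ⟶ (s', op t') from
      (homOfLE (leOfHom φ.1), 𝟙 (op t'))) ≫
      (show ((s', op t') : Fin R × (Fin L)ᵒᵖ) ⟶ (s', op t) from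
        (𝟙 s', (homOfLE (leOfHom φ.2.unop)).op)) :=
    grid_hom_ext _ _
  rw [hφ, F.map_comp, G.map_comp]
  exact heq_comp_of_heq (hobj _ _) (hobj _ _) (hobj _ _) (hvert _ _ _ _) (hhoriz _ _ _ _)

namespace CatMatrix

variable {C : Type u} [Category.{v} C] {n : ℕ} (M : CatMatrix C n)

lemma rows_le_colIdx (t : Fin M.cols) : M.rows ≤ M.colIdx t := Nat.le_add_right _ _

/-- The row of `M` at a vertex `a` among the first `M.rows`. -/
def rowOf {a : Fin (n + 1)} (h : (a : ℕ) < M.rows) : Fin M.rows := ⟨a, h⟩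

/-- The column of `M` at a vertex `b` that is not a row. -/
def colOf {b : Fin (n + 1)} (h : M.rows ≤ (b : ℕ)) : Fin M.cols :=
  ⟨b - M.rows, by have := M.rows_add_cols; omega⟩

lemma rowIdx_rowOf {a : Fin (n + 1)} (h : (a : ℕ) < M.rows) :
    M.rowIdx (M.rowOf h) = a := rfl

lemma colIdx_colOf {b : Fin (n + 1)} (h : M.rows ≤ (b : ℕ)) :
    M.colIdx (M.colOf h) = b := Fin.ext (Nat.add_sub_of_le h)

lemma colOf_colIdx (t : Fin M.cols) (h) : M.colOf (b := M.colIdx t) h = t :=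
  Fin.ext (Nat.add_sub_cancel_left _ _)

lemma rowOf_le_rowOf {a b : Fin (n + 1)} (hab : a ≤ b) (ha : (a : ℕ) < M.rows)
    (hb : (b : ℕ) < M.rows) : M.rowOf ha ≤ M.rowOf hb := hab

lemma colOf_le_colOf {a b : Fin (n + 1)} (hab : a ≤ b) (ha : M.rows ≤ (a : ℕ))
    (hb : M.rows ≤ (b : ℕ)) : M.colOf ha ≤ M.colOf hb := Nat.sub_le_sub_right hab _

end CatMatrix

namespace IsMatrixOf

variable {n : ℕ} {σ : DuskinSimplex (MultiSuspension D) n} {i : Fin r} {M : CatMatrix (D i) n}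

lemma rows_le_iff (hM : IsMatrixOf σ i M) (t : Fin (n + 1)) :
    M.rows ≤ t ↔ i.castSucc < (σ.obj t).idx := by
  rw [← not_lt, hM.lt_rows_iff, not_le]

end IsMatrixOf

/-! ### The matrices of a simplex -/

namespace DuskinSimplex

variable {n : ℕ} (σ : DuskinSimplex (MultiSuspension D) n) (i : Fin r)

/-- The number of vertices of `σ` in `{x_0, …, x_i}`. -/
def rowCount : ℕ := CatMatrix.restrictRows σ.idxHom (i + 1)

lemma rowCount_le : σ.rowCount i ≤ n + 1 := CatMatrix.restrictRows_le _ _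

lemma lt_rowCount_iff (t : Fin (n + 1)) :
    (t : ℕ) < σ.rowCount i ↔ (σ.obj t).idx ≤ i.castSucc :=
  (CatMatrix.lt_restrictRows σ.idxHom (i + 1) t).trans Nat.lt_succ_iff

lemma rowCount_le_iff (t : Fin (n + 1)) :
    σ.rowCount i ≤ t ↔ i.castSucc < (σ.obj t).idx := by
  rw [← not_lt, lt_rowCount_iff, not_le]

/-- The `i`-th matrix of a simplex of the Duskin nerve of a suspension. -/
def matrix : CatMatrix (D i) n where
  rows := σ.rowCount i
  cols := n + 1 - σ.rowCount i
  rows_add_cols := Nat.add_sub_of_le (σ.rowCount_le i)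
  mat :=
    have hr (s : Fin (σ.rowCount i)) : (s : ℕ) < n + 1 := s.2.trans_le (σ.rowCount_le i)
    have hc (t : Fin (n + 1 - σ.rowCount i)) : σ.rowCount i + t < n + 1 := by omega
    have ha (s : Fin (σ.rowCount i)) : (σ.obj ⟨s, hr s⟩).idx ≤ i.castSucc :=
      (σ.lt_rowCount_iff i ⟨s, hr s⟩).1 s.2
    have hb (t : Fin (n + 1 - σ.rowCount i)) :
        i.castSucc < (σ.obj ⟨σ.rowCount i + t, hc t⟩).idx :=
      (σ.rowCount_le_iff i ⟨σ.rowCount i + t, hc t⟩).1 (Nat.le_add_right _ _)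
    have hab (s : Fin (σ.rowCount i)) (t : Fin (n + 1 - σ.rowCount i)) :
        (⟨s, hr s⟩ : Fin (n + 1)) ≤ ⟨σ.rowCount i + t, hc t⟩ :=
      s.2.le.trans (Nat.le_add_right _ _)
    have hcc {t t' : Fin (n + 1 - σ.rowCount i)} (h : t ≤ t') :
        (⟨σ.rowCount i + t, hc t⟩ : Fin (n + 1)) ≤ ⟨σ.rowCount i + t', hc t'⟩ :=
      Nat.add_le_add_left h _
    gridFunctor (fun s t => σ.entry i (hab s t) (ha s) (hb t))
      (fun {s s'} h t => σ.vertical i (Fin.mk_le_mk.2 h) (hab s' t) (ha s) (ha s') (hb t))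
      (fun s {t t'} h => σ.horizontal i (hab s t) (hcc h) (ha s) (hb t) (hb t'))
      (fun _ _ => σ.vertical_refl i _ _ _)
      (fun _ _ => σ.horizontal_refl i _ _ _)
      (fun _ _ _ => σ.vertical_vertical i _ _ _ _ _ _ _)
      (fun _ _ _ _ h _ => σ.horizontal_horizontal i _ (hcc h) _ _ _ _ _)
      (fun _ _ _ _ => σ.vertical_horizontal i _ _ _ _ _ _ _)

lemma isMatrixOf_matrix : IsMatrixOf σ i (σ.matrix i) where
  lt_rows_iff t := σ.lt_rowCount_iff i t
  obj_eq _ _ _ _ := rfl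
  map_vertical s s' hs t h h' := by
    refine HEq.trans (b := σ.vertical i (CatMatrix.rowIdx_le_rowIdx _ hs)
      ((σ.matrix i).rowIdx_le_colIdx s' t) h
      ((σ.lt_rowCount_iff i ((σ.matrix i).rowIdx s')).1 s'.2) h') (heq_of_eq ?_)
      (comp_eqToHom_heq _ _)
    exact (congrArg (_ ≫ ·) (σ.horizontal_refl i _ _ _)).trans (Category.comp_id _)
  map_horizontal s t t' ht h h' := by
    refine HEq.trans (b := σ.horizontal i ((σ.matrix i).rowIdx_le_colIdx s t)
      (CatMatrix.colIdx_le_colIdx _ ht) h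
      ((σ.rowCount_le_iff i ((σ.matrix i).colIdx t)).1 (Nat.le_add_right _ _)) h')
      (heq_of_eq ?_) (comp_eqToHom_heq _ _)
    exact (congrArg (· ≫ _) (σ.vertical_refl i _ _ _)).trans (Category.id_comp _)

end DuskinSimplex

/-- An initial segment of `Fin n` determines its length. -/
lemma eq_of_forall_fin_lt_iff {n a b : ℕ} (ha : a ≤ n) (hb : b ≤ n)
    (h : ∀ t : Fin n, (t : ℕ) < a ↔ (t : ℕ) < b) : a = b := by
  by_contra hne
  rcases lt_or_gt_of_ne hne with hlt | hlt
  · have := h ⟨a, by omega⟩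
    simp only at this
    omega
  · have := h ⟨b, by omega⟩
    simp only at this
    omega

namespace IsMatrixOf

variable {n : ℕ} {σ : DuskinSimplex (MultiSuspension D) n} {i : Fin r} {M : CatMatrix (D i) n}

lemma idx_rowIdx_le (hM : IsMatrixOf σ i M) (s : Fin M.rows) :
    (σ.obj (M.rowIdx s)).idx ≤ i.castSucc :=
  (hM.lt_rows_iff _).1 s.2

lemma lt_idx_colIdx (hM : IsMatrixOf σ i M) (t : Fin M.cols) :
    i.castSucc < (σ.obj (M.colIdx t)).idx :=
  (hM.rows_le_iff _).1 (Nat.le_add_right _ _)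

/-- The `i`-th matrix of a simplex is unique. -/
theorem eq {N : CatMatrix (D i) n} (hM : IsMatrixOf σ i M) (hN : IsMatrixOf σ i N) : M = N := by
  obtain ⟨R, L, h, F⟩ := M
  obtain ⟨R', L', h', G⟩ := N
  obtain rfl : R = R' := eq_of_forall_fin_lt_iff (n := n + 1) (by omega) (by omega)
    fun t => (hM.lt_rows_iff t).trans (hN.lt_rows_iff t).symm
  obtain rfl : L = L' := by omega
  congr 1
  refine gridFunctor_ext (fun s t => ?_) (fun s s' hs t => ?_) fun s t t' ht => ?_
  · exact (hM.obj_eq s t (hM.idx_rowIdx_le s) (hM.lt_idx_colIdx t)).trans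
      (hN.obj_eq s t _ _).symm
  · exact (hM.map_vertical s s' hs t (hM.idx_rowIdx_le s) (hM.lt_idx_colIdx t)).trans
      (hN.map_vertical s s' hs t _ _).symm
  · exact (hM.map_horizontal s t t' ht (hM.idx_rowIdx_le s) (hM.lt_idx_colIdx t')).trans
      (hN.map_horizontal s t t' ht _ _).symm

variable {a b c : Fin (n + 1)}

/-- The entries of `M` in terms of vertices `a`, `b` that need not be literally of the form
`M.rowIdx s`, `M.colIdx t`; this absorbs the transport along `M.rows + (b - M.rows) = b`. -/
lemma obj_eq_val (hM : IsMatrixOf σ i M) {s : Fin M.rows} {t : Fin M.cols}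
    (hs : M.rowIdx s = a) (ht : M.colIdx t = b) (hab : a ≤ b)
    (ha : (σ.obj a).idx ≤ i.castSucc) (hb : i.castSucc < (σ.obj b).idx) :
    M.mat.obj (s, op t) = Hom.val (σ.hom hab) i ha hb := by
  subst hs ht
  exact hM.obj_eq s t ha hb

lemma map_heq_cell_of_row (hM : IsMatrixOf σ i M) {s s' : Fin M.rows} {t : Fin M.cols}
    (φ : ((s, op t) : Fin M.rows × (Fin M.cols)ᵒᵖ) ⟶ (s', op t))
    (hs : M.rowIdx s = a) (hs' : M.rowIdx s' = b) (ht : M.colIdx t = c)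
    (hab : a ≤ b) (hbc : b ≤ c) (ha : (σ.obj a).idx ≤ i.castSucc)
    (hc : i.castSucc < (σ.obj c).idx) :
    HEq (M.mat.map φ) (Hom₂.app (σ.cell hab hbc) i ha hc) := by
  subst hs hs' ht
  rw [grid_hom_ext φ (homOfLE (leOfHom φ.1), 𝟙 (op t))]
  exact hM.map_vertical s s' _ t ha hc

lemma map_heq_cell_of_col (hM : IsMatrixOf σ i M) {s : Fin M.rows} {t t' : Fin M.cols}
    (φ : ((s, op t') : Fin M.rows × (Fin M.cols)ᵒᵖ) ⟶ (s, op t))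
    (hs : M.rowIdx s = a) (ht : M.colIdx t = b) (ht' : M.colIdx t' = c)
    (hab : a ≤ b) (hbc : b ≤ c) (ha : (σ.obj a).idx ≤ i.castSucc)
    (hc : i.castSucc < (σ.obj c).idx) :
    HEq (M.mat.map φ) (Hom₂.app (σ.cell hab hbc) i ha hc) := by
  subst hs ht ht'
  rw [grid_hom_ext φ (𝟙 s, (homOfLE (leOfHom φ.2.unop)).op)]
  exact hM.map_horizontal s t t' _ ha hc

/-- Restriction along a simplicial operator is compatible with taking matrices. -/
theorem pullback (hM : IsMatrixOf σ i M) {k : ℕ} (f : Fin (k + 1) →o Fin (n + 1)) :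
    IsMatrixOf (σ.pullback f) i (M.pullback f) := by
  have hrow (s : Fin (M.pullback f).rows) :
      M.rowIdx (CatMatrix.rowMap f s) = f ((M.pullback f).rowIdx s) := rfl
  have hcol (t : Fin (M.pullback f).cols) :
      M.colIdx (CatMatrix.colMap f M.rows_add_cols t) = f ((M.pullback f).colIdx t) := by
    refine Fin.ext (Nat.add_sub_of_le ?_)
    exact not_lt.1 ((CatMatrix.lt_restrictRows f M.rows ((M.pullback f).colIdx t)).not.1
      (not_lt.2 (Nat.le_add_right _ _)))
  exact
  { lt_rows_iff := fun t => (CatMatrix.lt_restrictRows f M.rows t).trans (hM.lt_rows_iff (f t))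
    obj_eq := fun s t h h' => hM.obj_eq_val (hrow s) (hcol t) _ h h'
    map_vertical := fun s s' hs t h h' =>
      hM.map_heq_cell_of_row _ (hrow s) (hrow s') (hcol t) _ _ h h'
    map_horizontal := fun s t t' ht h h' =>
      hM.map_heq_cell_of_col _ (hrow s) (hcol t) (hcol t') _ _ h h' }

end IsMatrixOf

/-! ### A simplex is determined by its matrices -/

/-- An object `x_p` of the suspension is determined by which `i` satisfy `i < p`. -/
lemma eq_of_forall_castSucc_lt_iff {x y : Fin (r + 1)}
    (h : ∀ i : Fin r, i.castSucc < x ↔ i.castSucc < y) : x = y :=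
  Fin.ext (eq_of_forall_fin_lt_iff (Nat.lt_succ_iff.1 x.2) (Nat.lt_succ_iff.1 y.2) h)

namespace DuskinSimplex

variable {n : ℕ}

/-- A simplex is determined by its matrices: every component in `D m` of an edge is an entry, and
every component of a 2-cell is a vertical or horizontal morphism, as its middle vertex is a row or
a column. -/
theorem ext_of_isMatrixOf {σ τ : DuskinSimplex (MultiSuspension D) n}
    {M : ∀ i, CatMatrix (D i) n} (hσ : ∀ i, IsMatrixOf σ i (M i))
    (hτ : ∀ i, IsMatrixOf τ i (M i)) : σ = τ := by
  have hobj : σ.obj = τ.obj := funext fun t => MultiSuspension.ext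
    (eq_of_forall_castSucc_lt_iff fun i =>
      ((hσ i).rows_le_iff t).symm.trans ((hτ i).rows_le_iff t))
  obtain ⟨obj, hom, cell, _, _, _, _⟩ := σ
  obtain ⟨obj', hom', cell', _, _, _, _⟩ := τ
  obtain rfl : obj = obj' := hobj
  obtain rfl : @hom = @hom' := by
    funext a b hab
    refine Hom.ext (funext fun m => funext fun ha => funext fun hb => ?_)
    have ha' := ((hσ m).lt_rows_iff a).2 ha
    have hb' := ((hσ m).rows_le_iff b).2 hb
    exact ((hσ m).obj_eq_val ((M m).rowIdx_rowOf ha') ((M m).colIdx_colOf hb') hab ha hb).symm.trans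
      ((hτ m).obj_eq_val ((M m).rowIdx_rowOf ha') ((M m).colIdx_colOf hb') hab ha hb)
  obtain rfl : @cell = @cell' := by
    funext a b c hab hbc
    refine hom₂_ext fun m ha hc => ?_
    have ha' := ((hσ m).lt_rows_iff a).2 ha
    have hc' := ((hσ m).rows_le_iff c).2 hc
    by_cases hb : m.castSucc < (obj b).idx
    · have hb' := ((hσ m).rows_le_iff b).2 hb
      let φ : (((M m).rowOf ha', op ((M m).colOf hc')) : Fin (M m).rows × (Fin (M m).cols)ᵒᵖ) ⟶
          ((M m).rowOf ha', op ((M m).colOf hb')) :=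
        (𝟙 _, (homOfLE ((M m).colOf_le_colOf hbc hb' hc')).op)
      exact eq_of_heq (((hσ m).map_heq_cell_of_col φ
        ((M m).rowIdx_rowOf ha') ((M m).colIdx_colOf hb') ((M m).colIdx_colOf hc')
          hab hbc ha hc).symm.trans
        ((hτ m).map_heq_cell_of_col φ
          ((M m).rowIdx_rowOf ha') ((M m).colIdx_colOf hb') ((M m).colIdx_colOf hc')
          hab hbc ha hc))
    · have hb' := ((hσ m).lt_rows_iff b).2 (not_lt.1 hb)
      let φ : (((M m).rowOf ha', op ((M m).colOf hc')) : Fin (M m).rows × (Fin (M m).cols)ᵒᵖ) ⟶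
          ((M m).rowOf hb', op ((M m).colOf hc')) :=
        (homOfLE ((M m).rowOf_le_rowOf hab ha' hb'), 𝟙 _)
      exact eq_of_heq (((hσ m).map_heq_cell_of_row φ
        ((M m).rowIdx_rowOf ha') ((M m).rowIdx_rowOf hb') ((M m).colIdx_colOf hc')
          hab hbc ha hc).symm.trans
        ((hτ m).map_heq_cell_of_row φ
          ((M m).rowIdx_rowOf ha') ((M m).rowIdx_rowOf hb') ((M m).colIdx_colOf hc')
          hab hbc ha hc))
  rfl

end DuskinSimplex

/-! ### The simplex of a monotone tuple of matrices -/

namespace CatMatrix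

lemma map_heq_map {C : Type u} [Category.{v} C] {n : ℕ} (M : CatMatrix C n)
    {x y x' y' : Fin M.rows × (Fin M.cols)ᵒᵖ} (φ : x ⟶ y) (ψ : x' ⟶ y') (hx : x = x')
    (hy : y = y') : HEq (M.mat.map φ) (M.mat.map ψ) := by
  subst hx hy
  rw [grid_hom_ext φ ψ]

variable {n : ℕ} (M : ∀ i, CatMatrix (D i) n)

/-- The vertex `t` goes to `x_p`, where `p` is the number of matrices in which `t` is a column. -/
def suspensionObj (t : Fin (n + 1)) : MultiSuspension D where
  idx := ⟨(Finset.univ.filter fun i => (M i).rows ≤ t).card,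
    Nat.lt_succ_iff.2 ((Finset.card_le_univ _).trans_eq (Fintype.card_fin r))⟩

variable {M}

/-- As the numbers of rows increase, the matrices in which `t` is a column form an initial segment
of `Fin r`, so counting them recovers the set. -/
lemma castSucc_lt_suspensionObj_idx (hM : ∀ i j, i ≤ j → (M i).rows ≤ (M j).rows) (i : Fin r)
    (t : Fin (n + 1)) : i.castSucc < (suspensionObj M t).idx ↔ (M i).rows ≤ t := by
  rw [Fin.lt_def]
  change (i : ℕ) < (Finset.univ.filter fun i => (M i).rows ≤ t).card ↔ _
  constructor
  · intro h
    by_contra hi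
    have : (Finset.univ.filter fun i => (M i).rows ≤ t).card ≤ (Finset.Iio i).card := by
      refine Finset.card_le_card fun j hj => ?_
      rw [Finset.mem_filter] at hj
      rw [Finset.mem_Iio]
      by_contra hij
      exact hi ((hM i j (not_lt.1 hij)).trans hj.2)
    rw [Fin.card_Iio] at this
    omega
  · intro h
    have : (Finset.Iic i).card ≤ (Finset.univ.filter fun i => (M i).rows ≤ t).card := by
      refine Finset.card_le_card fun j hj => ?_
      rw [Finset.mem_filter]
      exact ⟨Finset.mem_univ _, (hM j i (Finset.mem_Iic.1 hj)).trans h⟩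
    rw [Fin.card_Iic] at this
    omega

lemma suspensionObj_idx_le_castSucc (hM : ∀ i j, i ≤ j → (M i).rows ≤ (M j).rows) (i : Fin r)
    (t : Fin (n + 1)) : (suspensionObj M t).idx ≤ i.castSucc ↔ (t : ℕ) < (M i).rows := by
  rw [← not_lt, castSucc_lt_suspensionObj_idx hM, not_le]

variable (hM : ∀ i j, i ≤ j → (M i).rows ≤ (M j).rows)

lemma suspensionObj_idx_mono {a b : Fin (n + 1)} (hab : a ≤ b) :
    (suspensionObj M a).idx ≤ (suspensionObj M b).idx := by
  rw [Fin.le_def]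
  dsimp only [suspensionObj]
  exact Finset.card_le_card
    (Finset.monotone_filter_right _ fun _ _ h => le_trans h (Fin.le_def.1 hab))

variable {a b c d : Fin (n + 1)}

/-- The edge `a ≤ b`, whose component in `D m` is the entry of `M m` at row `a` and column `b`. -/
def suspensionHom (hab : a ≤ b) : suspensionObj M a ⟶ suspensionObj M b :=
  show Hom _ _ from
  { le := suspensionObj_idx_mono hab
    val := fun m ha hb => (M m).mat.obj
      ((M m).rowOf ((suspensionObj_idx_le_castSucc hM m a).1 ha),
        op ((M m).colOf ((castSucc_lt_suspensionObj_idx hM m b).1 hb))) }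

section

variable (m : Fin r)

/-- The morphism of `D m` from row `a` to row `b` in column `c` of `M m`. -/
def suspensionVertical (hab : a ≤ b) (hbc : b ≤ c) (ha : (suspensionObj M a).idx ≤ m.castSucc)
    (hb : (suspensionObj M b).idx ≤ m.castSucc) (hc : m.castSucc < (suspensionObj M c).idx) :
    Hom.val (suspensionHom hM (hab.trans hbc)) m ha hc ⟶
      Hom.val (suspensionHom hM hbc) m hb hc :=
  (M m).mat.map (X := (_, _)) (Y := (_, _)) (homOfLE ((M m).rowOf_le_rowOf hab _ _), 𝟙 _)

/-- The morphism of `D m` from column `c` to column `b` in row `a` of `M m`. -/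
def suspensionHorizontal (hab : a ≤ b) (hbc : b ≤ c)
    (ha : (suspensionObj M a).idx ≤ m.castSucc) (hb : m.castSucc < (suspensionObj M b).idx)
    (hc : m.castSucc < (suspensionObj M c).idx) :
    Hom.val (suspensionHom hM (hab.trans hbc)) m ha hc ⟶
      Hom.val (suspensionHom hM hab) m ha hb :=
  (M m).mat.map (X := (_, _)) (Y := (_, _)) (𝟙 _, (homOfLE ((M m).colOf_le_colOf hbc _ _)).op)

lemma suspensionVertical_refl (hac : a ≤ c) (ha : (suspensionObj M a).idx ≤ m.castSucc)
    (hc : m.castSucc < (suspensionObj M c).idx) :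
    suspensionVertical hM m le_rfl hac ha ha hc = 𝟙 _ :=
  (congrArg (M m).mat.map (grid_hom_ext _ (𝟙 _))).trans ((M m).mat.map_id _)

lemma suspensionHorizontal_refl (hac : a ≤ c) (ha : (suspensionObj M a).idx ≤ m.castSucc)
    (hc : m.castSucc < (suspensionObj M c).idx) :
    suspensionHorizontal hM m hac le_rfl ha hc hc = 𝟙 _ :=
  (congrArg (M m).mat.map (grid_hom_ext _ (𝟙 _))).trans ((M m).mat.map_id _)

lemma suspensionVertical_comp (hab : a ≤ b) (hbc : b ≤ c) (hcd : c ≤ d)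
    (ha : (suspensionObj M a).idx ≤ m.castSucc) (hb : (suspensionObj M b).idx ≤ m.castSucc)
    (hc : (suspensionObj M c).idx ≤ m.castSucc) (hd : m.castSucc < (suspensionObj M d).idx) :
    suspensionVertical hM m hab (hbc.trans hcd) ha hb hd ≫
        suspensionVertical hM m hbc hcd hb hc hd =
      suspensionVertical hM m (hab.trans hbc) hcd ha hc hd :=
  ((M m).mat.map_comp _ _).symm.trans (congrArg (M m).mat.map (grid_hom_ext _ _))

lemma suspensionVertical_horizontal (hab : a ≤ b) (hbc : b ≤ c) (hcd : c ≤ d)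
    (ha : (suspensionObj M a).idx ≤ m.castSucc) (hb : (suspensionObj M b).idx ≤ m.castSucc)
    (hc : m.castSucc < (suspensionObj M c).idx) (hd : m.castSucc < (suspensionObj M d).idx) :
    suspensionVertical hM m hab (hbc.trans hcd) ha hb hd ≫
        suspensionHorizontal hM m hbc hcd hb hc hd =
      suspensionHorizontal hM m (hab.trans hbc) hcd ha hc hd ≫
        suspensionVertical hM m hab hbc ha hb hc :=
  ((M m).mat.map_comp _ _).symm.trans
    ((congrArg (M m).mat.map (grid_hom_ext _ _)).trans ((M m).mat.map_comp _ _))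

lemma suspensionHorizontal_comp (hab : a ≤ b) (hbc : b ≤ c) (hcd : c ≤ d)
    (ha : (suspensionObj M a).idx ≤ m.castSucc) (hb : m.castSucc < (suspensionObj M b).idx)
    (hc : m.castSucc < (suspensionObj M c).idx) (hd : m.castSucc < (suspensionObj M d).idx) :
    suspensionHorizontal hM m (hab.trans hbc) hcd ha hc hd ≫
        suspensionHorizontal hM m hab hbc ha hb hc =
      suspensionHorizontal hM m hab (hbc.trans hcd) ha hb hd :=
  ((M m).mat.map_comp _ _).symm.trans (congrArg (M m).mat.map (grid_hom_ext _ _))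

end

/-- The 2-cell of the triangle `a ≤ b ≤ c`: its component in `D m` is horizontal or vertical in
`M m`, as `b` is a column or a row there. -/
def suspensionCell (hab : a ≤ b) (hbc : b ≤ c) :
    suspensionHom hM (hab.trans hbc) ⟶ suspensionHom hM hab ≫ suspensionHom hM hbc :=
  show Hom₂ _ _ from
  { app := fun m ha hc =>
      if hb : m.castSucc < (suspensionObj M b).idx then
        suspensionHorizontal hM m hab hbc ha hb hc ≫
          eqToHom (Hom.comp_val_left (suspensionHom hM hab) (suspensionHom hM hbc)
            m ha hc hb).symm
      else
        suspensionVertical hM m hab hbc ha (not_lt.1 hb) hc ≫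
          eqToHom (Hom.comp_val_right (suspensionHom hM hab) (suspensionHom hM hbc)
            m ha hc (not_lt.1 hb)).symm }

lemma suspensionCell_app_of_lt (hab : a ≤ b) (hbc : b ≤ c) (m : Fin r)
    (ha : (suspensionObj M a).idx ≤ m.castSucc) (hc : m.castSucc < (suspensionObj M c).idx)
    (hb : m.castSucc < (suspensionObj M b).idx) :
    Hom₂.app (suspensionCell hM hab hbc) m ha hc =
      suspensionHorizontal hM m hab hbc ha hb hc ≫
        eqToHom (Hom.comp_val_left (suspensionHom hM hab) (suspensionHom hM hbc)
          m ha hc hb).symm :=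
  dif_pos hb

lemma suspensionCell_app_of_le (hab : a ≤ b) (hbc : b ≤ c) (m : Fin r)
    (ha : (suspensionObj M a).idx ≤ m.castSucc) (hc : m.castSucc < (suspensionObj M c).idx)
    (hb : (suspensionObj M b).idx ≤ m.castSucc) :
    Hom₂.app (suspensionCell hM hab hbc) m ha hc =
      suspensionVertical hM m hab hbc ha hb hc ≫
        eqToHom (Hom.comp_val_right (suspensionHom hM hab) (suspensionHom hM hbc)
          m ha hc hb).symm :=
  dif_neg (not_lt.2 hb)

lemma suspensionHom_refl (a : Fin (n + 1)) : suspensionHom hM (le_refl a) = 𝟙 _ :=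
  Hom.ext (funext fun _ => funext fun h => funext fun h' => absurd h' (not_lt.2 h))

/-- The simplex of the Duskin nerve given by a tuple of matrices with increasing numbers of rows.
The tetrahedron relation holds in each `D m` by functoriality of `M m`. -/
def suspensionSimplex : DuskinSimplex (MultiSuspension D) n where
  obj := suspensionObj M
  hom := suspensionHom hM
  cell := suspensionCell hM
  hom_refl := suspensionHom_refl hM
  cell_refl_left {a b} h := by
    refine hom₂_ext fun m ha hb => ?_
    rw [suspensionCell_app_of_le _ _ _ _ _ _ ha, comp_app', leftUnitor_inv_app,
      whiskerRight_app_of_le _ _ _ _ _ ha, eqToHom_trans,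
      suspensionVertical_refl]
    exact Category.id_comp _
  cell_refl_right {a b} h := by
    refine hom₂_ext fun m ha hb => ?_
    rw [suspensionCell_app_of_lt _ _ _ _ _ _ hb, comp_app', rightUnitor_inv_app,
      whiskerLeft_app_of_lt _ _ _ _ _ hb, eqToHom_trans,
      suspensionHorizontal_refl]
    exact Category.id_comp _
  tetrahedron {a b c d} hab hbc hcd := by
    refine hom₂_ext fun m ha hd => ?_
    simp only [comp_app', associator_hom_app]
    rcases lt_or_ge m.castSucc (suspensionObj M b).idx with hb | hb
    · have hc := hb.trans_le (suspensionObj_idx_mono hbc)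
      simp only [whiskerLeft_app_of_lt _ _ _ _ _ hb, whiskerRight_app_of_lt _ _ _ _ _ hc,
        suspensionCell_app_of_lt _ _ _ _ _ _ hb, suspensionCell_app_of_lt _ _ _ _ _ _ hc,
        Category.assoc, eqToHom_trans, eqToHom_trans_assoc, eqToHom_refl, Category.id_comp]
      rw [← reassoc_of% suspensionHorizontal_comp hM m hab hbc hcd ha hb hc hd]
    · rcases lt_or_ge m.castSucc (suspensionObj M c).idx with hc | hc
      · simp only [whiskerLeft_app_of_le _ _ _ _ _ hb, whiskerRight_app_of_lt _ _ _ _ _ hc,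
          suspensionCell_app_of_le _ _ _ _ _ _ hb, suspensionCell_app_of_lt _ _ _ _ _ _ hc,
          Category.assoc, eqToHom_trans, eqToHom_trans_assoc, eqToHom_refl, Category.id_comp]
        rw [reassoc_of% suspensionVertical_horizontal hM m hab hbc hcd ha hb hc hd]
      · simp only [whiskerLeft_app_of_le _ _ _ _ _ hb, whiskerRight_app_of_le _ _ _ _ _ hc,
          suspensionCell_app_of_le _ _ _ _ _ _ hb, suspensionCell_app_of_le _ _ _ _ _ _ hc,
          Category.assoc, eqToHom_trans, eqToHom_trans_assoc, eqToHom_refl, Category.id_comp]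
        rw [reassoc_of% suspensionVertical_comp hM m hab hbc hcd ha hb hc hd]

theorem isMatrixOf_suspensionSimplex (i : Fin r) : IsMatrixOf (suspensionSimplex hM) i (M i) where
  lt_rows_iff t := (suspensionObj_idx_le_castSucc hM i t).symm
  obj_eq s t h h' :=
    congrArg (fun t => (M i).mat.obj (s, op t))
      ((M i).colOf_colIdx t ((castSucc_lt_suspensionObj_idx hM i _).1 h')).symm
  map_vertical s s' hs t h h' := by
    have hb := (suspensionObj_idx_le_castSucc hM i ((M i).rowIdx s')).2 s'.2
    have ht := congrArg op ((M i).colOf_colIdx t ((castSucc_lt_suspensionObj_idx hM i _).1 h')).symm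
    refine HEq.trans (b := suspensionVertical hM i ((M i).rowIdx_le_rowIdx hs)
      ((M i).rowIdx_le_colIdx s' t) h hb h')
      ((M i).map_heq_map _ _ (Prod.ext rfl ht) (Prod.ext rfl ht))
      ((comp_eqToHom_heq _ _).symm.trans
        (heq_of_eq (suspensionCell_app_of_le hM _ _ i h h' hb).symm))
  map_horizontal s t t' ht h h' := by
    have hb := (castSucc_lt_suspensionObj_idx hM i ((M i).colIdx t)).2 ((M i).rows_le_colIdx t)
    have e := congrArg op ((M i).colOf_colIdx t ((M i).rows_le_colIdx t)).symm
    have e' := congrArg op ((M i).colOf_colIdx t' ((M i).rows_le_colIdx t')).symm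
    refine HEq.trans (b := suspensionHorizontal hM i ((M i).rowIdx_le_colIdx s t)
      ((M i).colIdx_le_colIdx ht) h hb h')
      ((M i).map_heq_map _ _ (Prod.ext rfl e') (Prod.ext rfl e))
      ((comp_eqToHom_heq _ _).symm.trans
        (heq_of_eq (suspensionCell_app_of_lt hM _ _ i h h' hb).symm))

end CatMatrix

/-! ### The isomorphism -/

namespace DuskinSimplex

variable {n : ℕ}

lemma rowCount_mono (σ : DuskinSimplex (MultiSuspension D) n) : Monotone σ.rowCount := by
  unfold Monotone rowCount CatMatrix.restrictRows
  refine fun i j hij => Finset.card_le_card fun t ht => ?_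
  simp only [Finset.mem_filter, Finset.mem_univ, true_and] at ht ⊢
  exact ht.trans_le (Nat.succ_le_succ hij)

lemma matrix_injective :
    Function.Injective fun (σ : DuskinSimplex (MultiSuspension D) n) i => σ.matrix i :=
  fun σ τ h => ext_of_isMatrixOf σ.isMatrixOf_matrix fun i => by
    have hi : σ.matrix i = τ.matrix i := congrFun h i
    rw [hi]
    exact τ.isMatrixOf_matrix i

lemma matrix_suspensionSimplex {M : ∀ i, CatMatrix (D i) n}
    (hM : ∀ i j, i ≤ j → (M i).rows ≤ (M j).rows) (i : Fin r) :
    (CatMatrix.suspensionSimplex hM).matrix i = M i :=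
  (isMatrixOf_matrix _ i).eq (CatMatrix.isMatrixOf_suspensionSimplex hM i)

lemma matrix_pullback {k : ℕ} (σ : DuskinSimplex (MultiSuspension D) n)
    (f : Fin (k + 1) →o Fin (n + 1)) (i : Fin r) :
    (σ.pullback f).matrix i = (σ.matrix i).pullback f :=
  (isMatrixOf_matrix _ i).eq ((σ.isMatrixOf_matrix i).pullback f)

end DuskinSimplex

/-- The bijection between simplices and tuples of matrices with increasing numbers of rows. -/
def duskinSimplexEquiv (n : ℕ) : DuskinSimplex (MultiSuspension D) n ≃
    {M : ∀ i, CatMatrix (D i) n // ∀ i j, i ≤ j → (M i).rows ≤ (M j).rows} where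
  toFun σ := ⟨fun i => σ.matrix i, fun _ _ hij => σ.rowCount_mono hij⟩
  invFun M := CatMatrix.suspensionSimplex M.2
  left_inv _ := DuskinSimplex.matrix_injective
    (funext fun i => DuskinSimplex.matrix_suspensionSimplex _ i)
  right_inv M := Subtype.ext (funext fun i => DuskinSimplex.matrix_suspensionSimplex M.2 i)

/-- The isomorphism of simplicial sets that sends a simplex to the tuple of its matrices. -/
def duskinNerveIso :
    duskinNerve (MultiSuspension D) ≅ (monotoneMatrixTuples D).toSSet :=
  NatIso.ofComponents (fun n => Equiv.toIso (duskinSimplexEquiv n.unop.len)) fun f => by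
    ext σ
    exact Subtype.ext (funext fun i => DuskinSimplex.matrix_pullback σ f.unop.toOrderHom i)

theorem theorem3 {r : ℕ} :
    (∀ (D : Fin r → Type u) [∀ i, Category.{v} (D i)],
      ∃ e : duskinNerve (MultiSuspension D) ≅ (monotoneMatrixTuples D).toSSet,
        ∀ (n : ℕ) (σ : DuskinSimplex (MultiSuspension D) n) (i : Fin r),
          IsMatrixOf σ i ((e.hom.app (op (SimplexCategory.mk n)) σ).1 i)) ∧
    (∀ m : Fin r → ℕ,
      ∃ e : duskinNerve (ThetaTwoCell r m) ≅
          (monotoneMatrixTuples fun i => Fin (m i + 1)).toSSet,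
        ∀ (n : ℕ) (σ : DuskinSimplex (ThetaTwoCell r m) n) (i : Fin r),
          IsMatrixOf σ i ((e.hom.app (op (SimplexCategory.mk n)) σ).1 i)) :=
  ⟨fun _ _ => ⟨duskinNerveIso, fun _ σ i => σ.isMatrixOf_matrix i⟩,
    fun _ => ⟨duskinNerveIso, fun _ σ i => σ.isMatrixOf_matrix i⟩⟩
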